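/- Let $B=(B(w))_{w\ge 0}$ be a standard Brownian motion, let $\delta>0$ and $\gamma\in\mathbb R$, let $$G(t)=\inf\{w>0:\ B(w)+\gamma w>\delta t\}$$ be the inverse Gaussian process (with $\inf\emptyset=\infty$), and let $$Q(t)=\inf\{w>0:\ G(w)>t\}$$ be its first-exit time. Then for every $t>0$ the random variable $Q(t)$ is almost surely finite, and its law is absolutely continuous with respect to Lebesgue measure and carried by $(0,\infty)$, with density $$h_{\delta,\gamma}(x,t)=\sum_{k=0}^{\infty}e^{-\frac{\gamma^2}{2}t+\delta\gamma x}\,\frac{(-x)^k t^{-k/2}}{k!}\,(\sqrt2\,\delta)^{k+1}\sum_{m=0}^{\infty}\left[\frac{(t\gamma^2/2)^m\,t^{-1/2}}{\Gamma\left(-\frac k2+m+\frac12\right)}-\frac{t^m\gamma^{2m+1}}{2^{m+1/2}\,\Gamma\left(-\frac k2+1+m\right)}\right],\qquad x>0,$$ where $1/\Gamma$ is understood as $0$ at the poles of $\Gamma$. For every $x>0$, each inner series (over $m$) and the outer series (over $k$) converge absolutely, and $h_{\delta,\gamma}(x,t)\ge 0$. -/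

import Mathlib

open MeasureTheory ProbabilityTheory Set
open scoped NNReal ENNReal Nat

noncomputable section

/-- The inverse Gaussian process with parameters `δ` and `γ` built from the process `B`:
`G(t) = inf {w > 0 : B(w) + γ w > δ t}`, the first time at which `B` with drift `γ` exceeds
the level `δ t`. It is `∞` if the level is never exceeded (which can happen only for `γ < 0`
when `B` is a Brownian motion). -/
def inverseGaussianProcess {Ω : Type*} (B : ℝ≥0 → Ω → ℝ) (δ γ : ℝ) (t : ℝ≥0) (ω : Ω) : ℝ≥0∞ :=
  sInf ((fun w : ℝ≥0 => (w : ℝ≥0∞)) '' {w : ℝ≥0 | 0 < w ∧ δ * (t : ℝ) < B w ω + γ * (w : ℝ)})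

/-- The first-exit time of the inverse Gaussian process: `Q(t) = inf {w > 0 : G(w) > t}`. -/
def inverseGaussianExitTime {Ω : Type*} (B : ℝ≥0 → Ω → ℝ) (δ γ : ℝ) (t : ℝ≥0) (ω : Ω) : ℝ≥0∞ :=
  sInf ((fun w : ℝ≥0 => (w : ℝ≥0∞)) ''
    {w : ℝ≥0 | 0 < w ∧ (t : ℝ≥0∞) < inverseGaussianProcess B δ γ w ω})

/-- The `(k, m)` term of the inner series. `Real.Gamma` takes the value `0` at the poles
`0, -1, -2, …` of the Gamma function, so a quotient by it is `0` there, which is the usual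
convention for the (entire) reciprocal Gamma function. -/
def exitDensityInnerTerm (γ t : ℝ) (k m : ℕ) : ℝ :=
  (t * γ ^ 2 / 2) ^ m * t ^ (-(1 / 2) : ℝ) / Real.Gamma (-(k : ℝ) / 2 + (m : ℝ) + 1 / 2)
    - t ^ m * γ ^ (2 * m + 1) /
      ((2 : ℝ) ^ ((m : ℝ) + 1 / 2) * Real.Gamma (-(k : ℝ) / 2 + 1 + (m : ℝ)))

/-- The `k`-th term of the outer series. -/
def exitDensityTerm (δ γ t x : ℝ) (k : ℕ) : ℝ :=
  Real.exp (-γ ^ 2 / 2 * t + δ * γ * x) * ((-x) ^ k * t ^ (-(k : ℝ) / 2) / (k ! : ℝ))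
    * (Real.sqrt 2 * δ) ^ (k + 1) * ∑' m : ℕ, exitDensityInnerTerm γ t k m

/-- The sum of the double series. -/
def exitDensity (δ γ t x : ℝ) : ℝ :=
  ∑' k : ℕ, exitDensityTerm δ γ t x k

end

/-! Probabilistically, `G(w) > t` essentially says that the drifted path `X_s = B_s + γ s` has not
exceeded `δ w` by time `t`. Hence `Q(t) = max_{s ≤ t} X_s / δ` almost surely, and the claim is about
the law of the maximum of a Brownian motion with drift.

The tail of the maximum comes from a martingale form of reflection. The weight `r(x) = 1_{x > y} (1
+ exp (2γ(y - x)))` is chosen so that its expectation after any positive time is exactly `1` for a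
path started at the level `y` (`integral_reflectionWeight`, `exitTail_zero`). Conditioning at the
first passage of `y` before `t` gives `P(max > y) = E r(X_t)`, an explicit combination of two
Gaussian tails. The strong Markov property is replaced by the Markov property at the first crossing
on a finite grid (`integral_crossingValue`), followed by dominated convergence as the grid is
refined (`measureReal_exists_lt_brownian`).

Analytically, put `u = γ √(t/2)`, `z = √2 δ x / √t`, `c_k = 1/Γ((1 - k)/2)` and `S_k = ∑ (-u)^n /
Γ((n - k + 1)/2)`. The inner series is `S_k / √t`, and `S_{k+1} = c_{k+1} - u S_k`. So `F(z) = ∑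
(-1)^k S_k z^k / k!` satisfies a linear first order equation forced by the derivative of `∑ (-1)^k
c_k z^k / k! = π^(-1/2) exp (-z²/4)`. Solving it (`tsum_halfGammaSum_coeff`) shows that the double
series is minus the `x`-derivative of the tail (`hasDerivAt_exitTail`). -/

/-! ### Entire power series -/

/-- An everywhere absolutely convergent real power series can be differentiated term by term. -/
theorem hasDerivAt_tsum_mul_pow {b : ℕ → ℝ} (hb : ∀ R : ℝ, 0 < R → Summable fun k => |b k| * R ^ k)
    (z : ℝ) :
    HasDerivAt (fun z => ∑' k, b k * z ^ k) (∑' k : ℕ, ((k : ℝ) + 1) * b (k + 1) * z ^ k) z := by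
  set R : ℝ := |z| + 1 with hR
  have hR0 : 0 < R := by positivity
  have hR1 : 1 ≤ R := by simp [hR]
  -- The factor `k` produced by differentiation is absorbed by `k ≤ 2 ^ k`, which is why the
  -- majorant is taken at radius `2 * R`.
  have hbound : ∀ k : ℕ, ∀ y ∈ Metric.ball (0 : ℝ) R,
      ‖b k * ((k : ℝ) * y ^ (k - 1))‖ ≤ |b k| * (2 * R) ^ k := by
    intro k y hy
    rw [mem_ball_zero_iff, Real.norm_eq_abs] at hy
    rw [norm_mul, norm_mul, norm_pow, Real.norm_eq_abs, Real.norm_eq_abs, Real.norm_eq_abs,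
      Nat.abs_cast, mul_pow]
    have h1 : (k : ℝ) ≤ 2 ^ k := by exact_mod_cast Nat.lt_two_pow_self.le
    have h2 : |y| ^ (k - 1) ≤ R ^ k :=
      (pow_le_pow_left₀ (abs_nonneg y) hy.le _).trans (pow_le_pow_right₀ hR1 (Nat.sub_le k 1))
    gcongr
  have hsum := hb (2 * R) (by positivity)
  have key := hasDerivAt_tsum_of_isPreconnected (t := Metric.ball (0 : ℝ) R) (y₀ := 0) (y := z)
    (g := fun k y => b k * y ^ k) (g' := fun k y => b k * ((k : ℝ) * y ^ (k - 1)))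
    hsum Metric.isOpen_ball (convex_ball _ _).isPreconnected
    (fun k y _ => (hasDerivAt_pow k y).const_mul (b k)) hbound (by simpa using hR0)
    (summable_of_ne_finset_zero (s := {0}) fun k hk => by
      have : k ≠ 0 := by simpa using hk
      simp [this])
    (by rw [mem_ball_zero_iff, Real.norm_eq_abs]; linarith)
  have hz : z ∈ Metric.ball (0 : ℝ) R := by
    rw [mem_ball_zero_iff, Real.norm_eq_abs]; linarith
  have hs : Summable fun k : ℕ => b k * ((k : ℝ) * z ^ (k - 1)) :=
    Summable.of_norm_bounded hsum fun k => hbound k z hz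
  rw [hs.tsum_eq_zero_add] at key
  refine key.congr_deriv ?_
  simp only [Nat.cast_zero, zero_mul, mul_zero, zero_add, Nat.add_sub_cancel, Nat.cast_add,
    Nat.cast_one]
  exact tsum_congr fun k => by ring

theorem summable_mul_pow {b : ℕ → ℝ} (hb : ∀ R : ℝ, 0 < R → Summable fun k => |b k| * R ^ k)
    (z : ℝ) : Summable fun k => b k * z ^ k := by
  refine Summable.of_norm_bounded (hb (|z| + 1) (by positivity)) fun k => ?_
  rw [norm_mul, norm_pow, Real.norm_eq_abs, Real.norm_eq_abs]
  gcongr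
  linarith [abs_nonneg z]

theorem summable_succ_mul_mul_pow {b : ℕ → ℝ}
    (hb : ∀ R : ℝ, 0 < R → Summable fun k => |b k| * R ^ k) (z : ℝ) :
    Summable fun k : ℕ => ((k : ℝ) + 1) * b (k + 1) * z ^ k := by
  have h := (summable_nat_add_iff 1).2 (hb (2 * (|z| + 1)) (by positivity))
  refine Summable.of_norm_bounded h fun k => ?_
  have h1 : (k : ℝ) + 1 ≤ 2 ^ (k + 1) := by exact_mod_cast (Nat.lt_two_pow_self (n := k + 1)).le
  have h2 : |z| ^ k ≤ (|z| + 1) ^ (k + 1) :=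
    (pow_le_pow_left₀ (abs_nonneg z) (by linarith) _).trans
      (pow_le_pow_right₀ (by linarith [abs_nonneg z]) (Nat.le_succ k))
  rw [norm_mul, norm_mul, norm_pow, Real.norm_eq_abs, Real.norm_eq_abs, Real.norm_eq_abs,
    abs_of_nonneg (by positivity), mul_comm ((k : ℝ) + 1), mul_assoc, mul_pow]
  gcongr

/-- A linear first order equation `y' = a y` with `a` the derivative of `A` has only the solutions
`y(z) = y(0) exp (A z - A 0)`. -/
theorem eq_mul_exp_of_hasDerivAt {f A a : ℝ → ℝ} (hA : ∀ z, HasDerivAt A (a z) z)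
    (hf : ∀ z, HasDerivAt f (a z * f z) z) (z : ℝ) : f z = f 0 * Real.exp (A z - A 0) := by
  have h : ∀ z, HasDerivAt (fun z => f z * Real.exp (-A z)) 0 z := fun z => by
    refine ((hf z).mul (hA z).neg.exp).congr_deriv ?_
    simp only [Pi.neg_apply]
    ring
  have := is_const_of_deriv_eq_zero (fun z => (h z).differentiableAt) (fun z => (h z).deriv) z 0
  rw [sub_eq_add_neg, add_comm, Real.exp_add, ← mul_assoc, ← this, mul_assoc, ← Real.exp_add]
  simp

/-! ### The reciprocal Gamma function at half-integers -/

/-- The reciprocal Gamma function at `(j + 1) / 2`, equal to `0` at the poles of `Γ`. -/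
noncomputable def halfGammaInv (j : ℤ) : ℝ := (Real.Gamma (((j : ℝ) + 1) / 2))⁻¹

theorem halfGammaInv_zero : halfGammaInv 0 = (√Real.pi)⁻¹ := by
  simp [halfGammaInv, ← one_div, Real.Gamma_one_half_eq]

theorem halfGammaInv_neg_one : halfGammaInv (-1) = 0 := by
  simp [halfGammaInv, Real.Gamma_zero]

/-- This is `Γ(s + 1) = s Γ(s)` at `s = (j + 1) / 2`. It survives at the poles, including `s = 0`,
because of the convention that `1/Γ` is `0` there. -/
theorem halfGammaInv_add_two (j : ℤ) :
    halfGammaInv (j + 2) * (((j : ℝ) + 1) / 2) = halfGammaInv j := by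
  unfold halfGammaInv
  by_cases h : ((j : ℝ) + 1) / 2 = 0
  · rw [h, mul_zero, Real.Gamma_zero, inv_zero]
  · rw [show (((j + 2 : ℤ) : ℝ) + 1) / 2 = ((j : ℝ) + 1) / 2 + 1 by push_cast; ring,
      Real.Gamma_add_one h, mul_inv, mul_right_comm, inv_mul_cancel₀ h, one_mul]

theorem halfGammaInv_neg_add_two (k : ℕ) :
    halfGammaInv (-((k : ℤ) + 2)) = -(((k : ℝ) + 1) / 2) * halfGammaInv (-(k : ℤ)) := by
  rw [← halfGammaInv_add_two (-((k : ℤ) + 2)),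
    show -((k : ℤ) + 2) + 2 = -(k : ℤ) by ring]
  push_cast
  ring

theorem halfGammaInv_two_mul_add_one (m : ℕ) : halfGammaInv (2 * m + 1) = (m ! : ℝ)⁻¹ := by
  rw [halfGammaInv, ← Real.Gamma_nat_eq_factorial]
  congr 2
  push_cast
  ring

/-- Two steps in `k` cost a factor `(k + 1) / 2`, while `√(k!)` gains `√((k + 1)(k + 2))`. Growth of
order `√(k!)` is what the `k!` in the outer series can beat. -/
theorem abs_halfGammaInv_neg_le (k : ℕ) : |halfGammaInv (-(k : ℤ))| ≤ √(k ! : ℝ) := by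
  induction k using Nat.twoStepInduction with
  | zero =>
    simp only [Nat.cast_zero, neg_zero, halfGammaInv_zero, Nat.factorial_zero, Nat.cast_one,
      Real.sqrt_one]
    rw [abs_of_nonneg (by positivity)]
    exact inv_le_one_of_one_le₀ (Real.one_le_sqrt.2 (by linarith [Real.pi_gt_three]))
  | one => simp [halfGammaInv_neg_one]
  | more k ih _ =>
    have h := halfGammaInv_neg_add_two k
    push_cast
    rw [h, abs_mul, abs_neg, abs_of_nonneg (by positivity), Nat.factorial_succ, Nat.factorial_succ]
    push_cast
    rw [← mul_assoc, Real.sqrt_mul (by positivity)]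
    refine mul_le_mul ?_ ih (abs_nonneg _) (Real.sqrt_nonneg _)
    apply Real.le_sqrt_of_sq_le
    nlinarith [(Nat.cast_nonneg k : (0 : ℝ) ≤ k)]

/-! ### The inner series -/

/-- The series `∑ u ^ (2 m) / Γ((2 m + j + 1) / 2)`. -/
noncomputable def evenHalfGammaSum (u : ℝ) (j : ℤ) : ℝ :=
  ∑' m : ℕ, u ^ (2 * m) * halfGammaInv (2 * m + j)

theorem summable_pow_mul_halfGammaInv (u : ℝ) (j : ℤ) :
    Summable fun m : ℕ => u ^ (2 * m) * halfGammaInv (2 * m + j) := by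
  refine summable_of_ratio_norm_eventually_le (r := 1 / 2) (by norm_num) ?_
  have hlim : Filter.Tendsto (fun m : ℕ => 2 * (m : ℝ) + ((j : ℝ) + 1)) Filter.atTop Filter.atTop :=
    Filter.tendsto_atTop_add_const_right _ _
      (tendsto_natCast_atTop_atTop.const_mul_atTop (by norm_num))
  -- The ratio of consecutive terms is `u² / ((2m + j + 1) / 2)`; the threshold makes it at most
  -- `1/2` and keeps the denominator positive.
  filter_upwards [hlim.eventually_ge_atTop (4 * u ^ 2 + 1)] with m hm
  have h := halfGammaInv_add_two (2 * m + j)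
  rw [show (2 * ((m + 1 : ℕ) : ℤ) + j) = 2 * m + j + 2 by push_cast; ring, ← h, norm_mul, norm_mul,
    norm_mul]
  push_cast
  rw [Real.norm_eq_abs ((2 * (m : ℝ) + j + 1) / 2),
    abs_of_nonneg (by nlinarith [sq_nonneg u]), norm_pow, norm_pow, mul_add, pow_add]
  simp only [mul_one, Real.norm_eq_abs, sq_abs]
  have h0 : 0 ≤ |u| ^ (2 * m) * |halfGammaInv (2 * m + j + 2)| := by positivity
  nlinarith [sq_nonneg u]

theorem evenHalfGammaSum_eq_add (u : ℝ) (j : ℤ) :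
    evenHalfGammaSum u j = halfGammaInv j + u ^ 2 * evenHalfGammaSum u (j + 2) := by
  unfold evenHalfGammaSum
  rw [(summable_pow_mul_halfGammaInv u j).tsum_eq_zero_add, ← tsum_mul_left]
  congr 1
  · simp
  · refine tsum_congr fun m => ?_
    rw [show (2 * ((m + 1 : ℕ) : ℤ) + j) = 2 * m + (j + 2) by push_cast; ring]
    ring

/-- The series `∑ (-u) ^ n / Γ((n - k + 1) / 2)`, with even and odd terms grouped. -/
noncomputable def halfGammaSum (u : ℝ) (k : ℕ) : ℝ :=
  evenHalfGammaSum u (-(k : ℤ)) - u * evenHalfGammaSum u (1 - (k : ℤ))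

/-- Raising `k` by one shifts the summation index: even and odd parts swap, and one new initial term
splits off. -/
theorem halfGammaSum_succ (u : ℝ) (k : ℕ) :
    halfGammaSum u (k + 1) = halfGammaInv (-((k : ℤ) + 1)) - u * halfGammaSum u k := by
  unfold halfGammaSum
  push_cast
  rw [evenHalfGammaSum_eq_add u (-((k : ℤ) + 1)),
    show -((k : ℤ) + 1) + 2 = 1 - k by ring, show (1 : ℤ) - (k + 1) = -k by ring]
  ring

theorem abs_halfGammaSum_le (u : ℝ) (k : ℕ) :
    |halfGammaSum u k| ≤ (1 + |halfGammaSum u 0|) * (1 + |u|) ^ k * √(k ! : ℝ) := by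
  induction k with
  | zero => simp
  | succ k ih =>
    have hK : 1 ≤ (1 + |halfGammaSum u 0|) * (1 + |u|) ^ k :=
      one_le_mul_of_one_le_of_one_le (by simp) (one_le_pow₀ (by simp))
    have hfac : √(k ! : ℝ) ≤ √((k + 1)! : ℝ) :=
      Real.sqrt_le_sqrt (by exact_mod_cast Nat.factorial_le (Nat.le_succ k))
    have hc := abs_halfGammaInv_neg_le (k + 1)
    push_cast at hc
    calc |halfGammaSum u (k + 1)|
        ≤ |halfGammaInv (-((k : ℤ) + 1))| + |u| * |halfGammaSum u k| := by
          rw [halfGammaSum_succ, ← abs_mul]; exact abs_sub _ _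
      _ ≤ (1 + |halfGammaSum u 0|) * (1 + |u|) ^ k * √((k + 1)! : ℝ)
          + |u| * ((1 + |halfGammaSum u 0|) * (1 + |u|) ^ k * √((k + 1)! : ℝ)) := by
          refine add_le_add (hc.trans (le_mul_of_one_le_left (Real.sqrt_nonneg _) hK)) ?_
          gcongr
          exact ih.trans (by gcongr)
      _ = _ := by ring

/-- A coefficient sequence growing at most like `ρ ^ k √(k!)` defines an entire function when
divided by `k!`. -/
theorem summable_abs_div_factorial_mul_pow {a : ℕ → ℝ} {K ρ : ℝ} (hρ : 0 ≤ ρ)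
    (ha : ∀ k, |a k| ≤ K * ρ ^ k * √(k ! : ℝ)) (R : ℝ) (hR : 0 < R) :
    Summable fun k : ℕ => |(-1) ^ k * a k / (k ! : ℝ)| * R ^ k := by
  have hsum : Summable fun k : ℕ => K * ((ρ * R) ^ k / √(k ! : ℝ)) := by
    refine Summable.mul_left K (summable_of_ratio_norm_eventually_le (r := 1 / 2) (by norm_num) ?_)
    have hlim : Filter.Tendsto (fun k : ℕ => √((k : ℝ) + 1)) Filter.atTop Filter.atTop :=
      Real.tendsto_sqrt_atTop.comp
        (Filter.tendsto_atTop_add_const_right _ _ tendsto_natCast_atTop_atTop)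
    filter_upwards [hlim.eventually_ge_atTop (2 * (ρ * R))] with k hk
    have hk0 : 0 < √((k : ℝ) + 1) := Real.sqrt_pos.2 (by positivity)
    have hf0 : 0 < √(k ! : ℝ) := Real.sqrt_pos.2 (by positivity)
    rw [Real.norm_of_nonneg (by positivity), Real.norm_of_nonneg (by positivity),
      Nat.factorial_succ]
    push_cast
    rw [Real.sqrt_mul (by positivity), pow_succ]
    rw [div_le_iff₀ (by positivity)]
    have h1 : 0 ≤ (ρ * R) ^ k := by positivity
    calc (ρ * R) ^ k * (ρ * R) ≤ (ρ * R) ^ k * (√((k : ℝ) + 1) / 2) := by gcongr; linarith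
      _ = _ := by field_simp
  refine Summable.of_nonneg_of_le (fun k => by positivity) (fun k => ?_) hsum
  have hf0 : 0 < √(k ! : ℝ) := Real.sqrt_pos.2 (by positivity)
  rw [abs_div, abs_mul, abs_pow, abs_neg, abs_one, one_pow, one_mul, Nat.abs_cast, mul_pow]
  have h2 : (k ! : ℝ) = √(k ! : ℝ) * √(k ! : ℝ) := (Real.mul_self_sqrt (by positivity)).symm
  calc |a k| / (k ! : ℝ) * R ^ k ≤ K * ρ ^ k * √(k ! : ℝ) / (k ! : ℝ) * R ^ k := by
        gcongr; exact ha k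
    _ = _ := by rw [h2, Real.sqrt_mul_self (Real.sqrt_nonneg _)]; field_simp

/-! ### The Gaussian tail -/

/-- The normalized Gaussian tail `π ^ (-1/2) ∫_c^∞ exp (-s²) ds`. -/
noncomputable def gaussTail (c : ℝ) : ℝ := (√Real.pi)⁻¹ * ∫ s in Ioi c, Real.exp (-s ^ 2)

theorem integrable_exp_neg_sq : Integrable fun s : ℝ => Real.exp (-s ^ 2) := by
  simpa using integrable_exp_neg_mul_sq (b := 1) one_pos

theorem gaussTail_zero : gaussTail 0 = 1 / 2 := by
  have h := integral_gaussian_Ioi 1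
  simp only [neg_mul, one_mul, div_one] at h
  rw [gaussTail, h]
  have : √Real.pi ≠ 0 := (Real.sqrt_pos.2 Real.pi_pos).ne'
  field_simp

theorem hasDerivAt_gaussTail (c : ℝ) :
    HasDerivAt gaussTail (-((√Real.pi)⁻¹ * Real.exp (-c ^ 2))) c := by
  have h : gaussTail = fun c => (√Real.pi)⁻¹ *
      ((∫ s in Ioi 0, Real.exp (-s ^ 2)) - ∫ s in (0 : ℝ)..c, Real.exp (-s ^ 2)) := by
    funext c
    rw [gaussTail, ← intervalIntegral.integral_Ioi_sub_Ioi' integrable_exp_neg_sq.integrableOn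
      integrable_exp_neg_sq.integrableOn]
    ring
  have hcont : Continuous fun s : ℝ => Real.exp (-s ^ 2) := by fun_prop
  rw [h]
  refine (((intervalIntegral.integral_hasDerivAt_right (hcont.intervalIntegrable _ _)
    (hcont.stronglyMeasurableAtFilter _ _) hcont.continuousAt).const_sub _).const_mul _).congr_deriv
    (by ring)

theorem continuous_gaussTail : Continuous gaussTail :=
  continuous_iff_continuousAt.2 fun c => (hasDerivAt_gaussTail c).continuousAt

theorem gaussTail_nonneg (c : ℝ) : 0 ≤ gaussTail c :=
  mul_nonneg (by positivity) (setIntegral_nonneg measurableSet_Ioi fun _ _ => (Real.exp_pos _).le)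

theorem gaussTail_add_gaussTail_neg (c : ℝ) : gaussTail c + gaussTail (-c) = 1 := by
  have hd : ∀ c, HasDerivAt (fun c => gaussTail c + gaussTail (-c)) 0 c := fun c => by
    refine ((hasDerivAt_gaussTail c).add
      ((hasDerivAt_gaussTail (-c)).comp c (hasDerivAt_neg c))).congr_deriv ?_
    rw [neg_sq]
    ring
  have h := is_const_of_deriv_eq_zero (fun z => (hd z).differentiableAt) (fun z => (hd z).deriv) c 0
  rw [h, neg_zero, gaussTail_zero]
  norm_num

theorem gaussTail_le_one (c : ℝ) : gaussTail c ≤ 1 := by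
  linarith [gaussTail_add_gaussTail_neg c, gaussTail_nonneg (-c)]

/-! ### Evaluation of the double series -/

theorem evenHalfGammaSum_one (u : ℝ) : evenHalfGammaSum u 1 = Real.exp (u ^ 2) := by
  rw [Real.exp_eq_exp_ℝ, NormedSpace.exp_eq_tsum_div, evenHalfGammaSum]
  refine tsum_congr fun m => ?_
  rw [halfGammaInv_two_mul_add_one, pow_mul]
  rfl

theorem summable_abs_halfGammaInv_mul_pow (j : ℤ) (R : ℝ) (hR : 0 < R) :
    Summable fun m : ℕ => |halfGammaInv (2 * m + j)| * R ^ m := by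
  refine (summable_pow_mul_halfGammaInv (√R) j).abs.congr fun m => ?_
  rw [pow_mul, Real.sq_sqrt hR.le, abs_mul, abs_of_pos (pow_pos hR m), mul_comm]

/-- As a power series in `u²` the sum can be differentiated termwise; the functional equation of `Γ`
turns the result into `y' = 2 u y + 2 / √π`, the equation of `exp (u²) erf u`. -/
theorem hasDerivAt_mul_evenHalfGammaSum_two (u : ℝ) :
    HasDerivAt (fun u => u * evenHalfGammaSum u 2)
      (2 * u * (u * evenHalfGammaSum u 2) + 2 * (√Real.pi)⁻¹) u := by
  set q : ℝ → ℝ := fun v => ∑' m : ℕ, halfGammaInv (2 * m + 2) * v ^ m with hq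
  have hsq : ∀ u, evenHalfGammaSum u 2 = q (u ^ 2) := fun u =>
    tsum_congr fun m => by rw [pow_mul, mul_comm]
  have hder : HasDerivAt q (evenHalfGammaSum u 2 - evenHalfGammaSum u 4 / 2) (u ^ 2) := by
    refine (hasDerivAt_tsum_mul_pow (summable_abs_halfGammaInv_mul_pow 2) (u ^ 2)).congr_deriv ?_
    have h2 := summable_pow_mul_halfGammaInv u 2
    have h4 := (summable_pow_mul_halfGammaInv u 4).div_const 2
    rw [evenHalfGammaSum, evenHalfGammaSum, ← tsum_div_const, ← h2.tsum_sub h4]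
    refine tsum_congr fun m => ?_
    have h := halfGammaInv_add_two (2 * m + 2)
    push_cast at h ⊢
    rw [← h, show 2 * ((m : ℤ) + 1) + 2 = 2 * m + 4 by ring,
      show (2 * (m : ℤ) + 2 + 2) = 2 * m + 4 by ring, pow_mul]
    ring
  have h1 := (hasDerivAt_id u).mul (HasDerivAt.comp (h := fun u : ℝ => u ^ 2) u hder (hasDerivAt_pow 2 u))
  have hc2 : halfGammaInv 2 = 2 * (√Real.pi)⁻¹ := by
    have h := halfGammaInv_add_two 0
    rw [halfGammaInv_zero] at h
    norm_num at h
    linarith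
  have h2 := evenHalfGammaSum_eq_add u 2
  norm_num at h2
  rw [funext fun u => congrArg (u * ·) (hsq u)]
  refine h1.congr_deriv ?_
  simp only [id, Function.comp, ← hsq]
  rw [← hc2]
  push_cast
  linear_combination (1 : ℝ) * h2

/-- The difference of the two sides solves `y' = 2 u y` and vanishes at `0`. -/
theorem mul_evenHalfGammaSum_two (u : ℝ) :
    u * evenHalfGammaSum u 2 = Real.exp (u ^ 2) * (1 - 2 * gaussTail u) := by
  have hd : ∀ u, HasDerivAt
      (fun u => u * evenHalfGammaSum u 2 - Real.exp (u ^ 2) * (1 - 2 * gaussTail u))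
      (2 * u * (u * evenHalfGammaSum u 2 - Real.exp (u ^ 2) * (1 - 2 * gaussTail u))) u := by
    intro u
    refine ((hasDerivAt_mul_evenHalfGammaSum_two u).sub ((hasDerivAt_pow 2 u).exp.mul
      (((hasDerivAt_gaussTail u).const_mul 2).const_sub 1))).congr_deriv ?_
    have h : Real.exp (u ^ 2) * Real.exp (-u ^ 2) = 1 := by rw [← Real.exp_add]; simp
    push_cast
    linear_combination (-2 * (√Real.pi)⁻¹) * h
  have h := eq_mul_exp_of_hasDerivAt (A := fun u => u ^ 2) (a := fun u => 2 * u)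
    (fun z => by simpa using hasDerivAt_pow 2 z) hd u
  rw [gaussTail_zero] at h
  norm_num at h
  linarith

theorem halfGammaSum_zero (u : ℝ) :
    halfGammaSum u 0 = (√Real.pi)⁻¹ - 2 * u * Real.exp (u ^ 2) * gaussTail u := by
  have h0 := evenHalfGammaSum_eq_add u 0
  have h2 := mul_evenHalfGammaSum_two u
  rw [halfGammaInv_zero, zero_add] at h0
  simp only [halfGammaSum, Nat.cast_zero, neg_zero, sub_zero]
  rw [evenHalfGammaSum_one, h0]
  linear_combination u * h2

theorem summable_abs_halfGammaInv_coeff (R : ℝ) (hR : 0 < R) :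
    Summable fun k : ℕ => |(-1) ^ k * halfGammaInv (-(k : ℤ)) / (k ! : ℝ)| * R ^ k :=
  summable_abs_div_factorial_mul_pow (K := 1) (ρ := 1) zero_le_one
    (fun k => by simpa using abs_halfGammaInv_neg_le k) R hR

theorem summable_abs_halfGammaSum_coeff (u R : ℝ) (hR : 0 < R) :
    Summable fun k : ℕ => |(-1) ^ k * halfGammaSum u k / (k ! : ℝ)| * R ^ k :=
  summable_abs_div_factorial_mul_pow (by positivity) (abs_halfGammaSum_le u) R hR

/-- The two-step recurrence for `1/Γ` becomes `C' = -(z/2) C` for the generating function `C`. The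
constant term of `C'` drops out because `1/Γ(0) = 0`. -/
theorem tsum_succ_mul_halfGammaInv_coeff (z : ℝ) :
    ∑' k : ℕ, ((k : ℝ) + 1) * ((-1) ^ (k + 1) * halfGammaInv (-((k + 1 : ℕ) : ℤ)) / ((k + 1)! : ℝ))
        * z ^ k
      = -(z / 2) * ∑' k : ℕ, (-1) ^ k * halfGammaInv (-(k : ℤ)) / (k ! : ℝ) * z ^ k := by
  have hterm : ∀ k : ℕ, ((k + 1 : ℕ) + 1 : ℝ) *
      ((-1) ^ (k + 1 + 1) * halfGammaInv (-((k + 1 + 1 : ℕ) : ℤ)) / ((k + 1 + 1)! : ℝ)) * z ^ (k + 1)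
      = -(z / 2) * ((-1) ^ k * halfGammaInv (-(k : ℤ)) / (k ! : ℝ) * z ^ k) := by
    intro k
    have h := halfGammaInv_neg_add_two k
    rw [show -((k + 1 + 1 : ℕ) : ℤ) = -((k : ℤ) + 2) by push_cast; ring, h,
      Nat.factorial_succ, Nat.factorial_succ]
    have h1 : (k ! : ℝ) ≠ 0 := by positivity
    have h2 : (k : ℝ) + 1 ≠ 0 := by positivity
    have h3 : (k : ℝ) + 1 + 1 ≠ 0 := by positivity
    push_cast
    field_simp
    ring
  rw [← tsum_mul_left, tsum_eq_zero_add']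
  · simp only [hterm]
    simp [halfGammaInv_neg_one]
  · simp only [hterm]
    exact (summable_mul_pow summable_abs_halfGammaInv_coeff z).mul_left _

theorem tsum_halfGammaInv_coeff (z : ℝ) :
    ∑' k : ℕ, (-1) ^ k * halfGammaInv (-(k : ℤ)) / (k ! : ℝ) * z ^ k
      = (√Real.pi)⁻¹ * Real.exp (-z ^ 2 / 4) := by
  have h := eq_mul_exp_of_hasDerivAt (A := fun z => -z ^ 2 / 4) (a := fun z => -(z / 2))
    (f := fun z => ∑' k : ℕ, (-1) ^ k * halfGammaInv (-(k : ℤ)) / (k ! : ℝ) * z ^ k)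
    (fun z => ((hasDerivAt_pow 2 z).neg.div_const 4).congr_deriv (by push_cast; ring))
    (fun z => (hasDerivAt_tsum_mul_pow summable_abs_halfGammaInv_coeff z).congr_deriv
      (tsum_succ_mul_halfGammaInv_coeff z)) z
  rw [h, tsum_eq_single 0 fun k hk => by simp [hk]]
  simp [halfGammaInv_zero]

/-- Termwise, `halfGammaSum_succ` reads `F' = C' + u F`, with `C` the Gaussian generating function
already evaluated. -/
theorem hasDerivAt_tsum_halfGammaSum_coeff (u z : ℝ) :
    HasDerivAt (fun z => ∑' k : ℕ, (-1) ^ k * halfGammaSum u k / (k ! : ℝ) * z ^ k)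
      (u * (∑' k : ℕ, (-1) ^ k * halfGammaSum u k / (k ! : ℝ) * z ^ k)
        - z / 2 * ((√Real.pi)⁻¹ * Real.exp (-z ^ 2 / 4))) z := by
  refine (hasDerivAt_tsum_mul_pow (summable_abs_halfGammaSum_coeff u) z).congr_deriv ?_
  have h1 := tsum_succ_mul_halfGammaInv_coeff z
  rw [tsum_halfGammaInv_coeff] at h1
  have hs : Summable fun k : ℕ => u * ((-1) ^ k * halfGammaSum u k / (k ! : ℝ) * z ^ k) :=
    (summable_mul_pow (summable_abs_halfGammaSum_coeff u) z).mul_left u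
  have hterm : ∀ k : ℕ,
      ((k : ℝ) + 1) * ((-1) ^ (k + 1) * halfGammaSum u (k + 1) / ((k + 1)! : ℝ)) * z ^ k
      = ((k : ℝ) + 1) * ((-1) ^ (k + 1) * halfGammaInv (-((k + 1 : ℕ) : ℤ)) / ((k + 1)! : ℝ)) * z ^ k
        + u * ((-1) ^ k * halfGammaSum u k / (k ! : ℝ) * z ^ k) := by
    intro k
    rw [halfGammaSum_succ, Nat.factorial_succ]
    have h1 : (k ! : ℝ) ≠ 0 := by positivity
    have h2 : (k : ℝ) + 1 ≠ 0 := by positivity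
    push_cast
    field_simp
    ring
  have hs' : Summable fun k : ℕ => ((k : ℝ) + 1) *
      ((-1) ^ (k + 1) * halfGammaInv (-((k + 1 : ℕ) : ℤ)) / ((k + 1)! : ℝ)) * z ^ k :=
    summable_succ_mul_mul_pow summable_abs_halfGammaInv_coeff z
  rw [tsum_congr hterm, hs'.tsum_add hs, h1, tsum_mul_left]
  ring

/-- The difference of the two sides solves `y' = u y`, and `halfGammaSum_zero` makes it vanish at `z
= 0`. -/
theorem tsum_halfGammaSum_coeff (u z : ℝ) :
    ∑' k : ℕ, (-1) ^ k * halfGammaSum u k / (k ! : ℝ) * z ^ k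
      = (√Real.pi)⁻¹ * Real.exp (-z ^ 2 / 4)
        - 2 * u * Real.exp (u * z + u ^ 2) * gaussTail (z / 2 + u) := by
  have hd : ∀ z, HasDerivAt (fun z => (∑' k : ℕ, (-1) ^ k * halfGammaSum u k / (k ! : ℝ) * z ^ k)
      - ((√Real.pi)⁻¹ * Real.exp (-z ^ 2 / 4)
        - 2 * u * Real.exp (u * z + u ^ 2) * gaussTail (z / 2 + u)))
      (u * ((∑' k : ℕ, (-1) ^ k * halfGammaSum u k / (k ! : ℝ) * z ^ k)
      - ((√Real.pi)⁻¹ * Real.exp (-z ^ 2 / 4)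
        - 2 * u * Real.exp (u * z + u ^ 2) * gaussTail (z / 2 + u)))) z := by
    intro z
    have e1 : HasDerivAt (fun z : ℝ => -z ^ 2 / 4) (-(2 * z) / 4) z :=
      ((hasDerivAt_pow 2 z).neg.div_const 4).congr_deriv (by push_cast; ring)
    have e2 : HasDerivAt (fun z : ℝ => u * z + u ^ 2) u z :=
      (((hasDerivAt_id z).const_mul u).add_const (u ^ 2)).congr_deriv (by ring)
    have e3 : HasDerivAt (fun z : ℝ => z / 2 + u) (1 / 2) z :=
      ((hasDerivAt_id z).div_const 2).add_const u
    refine ((hasDerivAt_tsum_halfGammaSum_coeff u z).sub ((e1.exp.const_mul _).sub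
      ((e2.exp.const_mul (2 * u)).mul ((hasDerivAt_gaussTail _).comp z e3)))).congr_deriv ?_
    have h : Real.exp (u * z + u ^ 2) * Real.exp (-(z / 2 + u) ^ 2) = Real.exp (-z ^ 2 / 4) := by
      rw [← Real.exp_add]
      congr 1
      ring
    simp only [Function.comp]
    linear_combination (-u * (√Real.pi)⁻¹) * h
  have h := eq_mul_exp_of_hasDerivAt (A := fun z => u * z) (a := fun _ => u)
    (fun z => by simpa using (hasDerivAt_id z).const_mul u) hd z
  have h0 : ∑' k : ℕ, (-1) ^ k * halfGammaSum u k / (k ! : ℝ) * 0 ^ k = halfGammaSum u 0 := by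
    rw [tsum_eq_single 0 fun k hk => by simp [hk]]
    simp
  rw [h0] at h
  simp [halfGammaSum_zero] at h
  linarith

/-! ### The exit density in closed form -/

theorem exitDensityInnerTerm_eq (γ : ℝ) {t : ℝ} (ht : 0 < t) (k m : ℕ) :
    exitDensityInnerTerm γ t k m = (√t)⁻¹ *
      ((γ * √(2 * t) / 2) ^ (2 * m) * halfGammaInv (2 * m + -(k : ℤ))
        - γ * √(2 * t) / 2 *
          ((γ * √(2 * t) / 2) ^ (2 * m) * halfGammaInv (2 * m + (1 - (k : ℤ))))) := by
  have hs : √t ≠ 0 := (Real.sqrt_pos.2 ht).ne'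
  have hr : √(2 : ℝ) ≠ 0 := (Real.sqrt_pos.2 two_pos).ne'
  have hr2 : √(2 : ℝ) * √2 = 2 := Real.mul_self_sqrt (by norm_num)
  have hu : (γ * √(2 * t) / 2) ^ (2 * m) = (t * γ ^ 2 / 2) ^ m := by
    rw [pow_mul, div_pow, mul_pow, Real.sq_sqrt (by positivity)]
    congr 1
    ring
  have h1 : t ^ (-(1 / 2) : ℝ) = (√t)⁻¹ := by rw [Real.rpow_neg ht.le, Real.sqrt_eq_rpow]
  have h2 : (2 : ℝ) ^ ((m : ℝ) + 1 / 2) = 2 ^ m * √2 := by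
    rw [Real.rpow_add two_pos, Real.rpow_natCast, Real.sqrt_eq_rpow]
  have e1 : -(k : ℝ) / 2 + (m : ℝ) + 1 / 2 = (((2 * m + -(k : ℤ) : ℤ) : ℝ) + 1) / 2 := by
    push_cast; ring
  have e2 : -(k : ℝ) / 2 + 1 + (m : ℝ) = (((2 * m + (1 - (k : ℤ)) : ℤ) : ℝ) + 1) / 2 := by
    push_cast; ring
  rw [exitDensityInnerTerm, hu, h1, h2, e1, e2, div_eq_mul_inv _ (Real.Gamma _),
    div_eq_mul_inv _ (_ * Real.Gamma _), mul_inv]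
  change _ * halfGammaInv _ - _ * (_ * halfGammaInv _) = _
  rw [Real.sqrt_mul two_pos.le]
  have h3 : (2 ^ m * √2 : ℝ)⁻¹ * (t ^ m * γ ^ (2 * m + 1))
      = (√t)⁻¹ * (γ * (√2 * √t) / 2 * (t * γ ^ 2 / 2) ^ m) := by
    rw [div_pow, mul_pow, ← pow_mul, pow_succ]
    field_simp
    rw [sq, hr2]
    ring
  linear_combination (-halfGammaInv (2 * m + (1 - (k : ℤ)))) * h3

theorem summable_exitDensityInnerTerm (γ : ℝ) {t : ℝ} (ht : 0 < t) (k : ℕ) :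
    Summable fun m : ℕ => exitDensityInnerTerm γ t k m :=
  (((summable_pow_mul_halfGammaInv _ _).sub
    ((summable_pow_mul_halfGammaInv _ _).mul_left _)).mul_left _).congr
    fun m => (exitDensityInnerTerm_eq γ ht k m).symm

theorem tsum_exitDensityInnerTerm (γ : ℝ) {t : ℝ} (ht : 0 < t) (k : ℕ) :
    ∑' m : ℕ, exitDensityInnerTerm γ t k m = (√t)⁻¹ * halfGammaSum (γ * √(2 * t) / 2) k := by
  rw [tsum_congr (exitDensityInnerTerm_eq γ ht k), tsum_mul_left, Summable.tsum_sub
    (summable_pow_mul_halfGammaInv _ _) ((summable_pow_mul_halfGammaInv _ _).mul_left _),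
    tsum_mul_left]
  rfl

theorem exitDensityTerm_eq (δ γ : ℝ) {t : ℝ} (ht : 0 < t) (x : ℝ) (k : ℕ) :
    exitDensityTerm δ γ t x k = Real.exp (-γ ^ 2 / 2 * t + δ * γ * x) * (√2 * δ / √t) *
      ((-1) ^ k * halfGammaSum (γ * √(2 * t) / 2) k / (k ! : ℝ) * (√2 * δ * x / √t) ^ k) := by
  have h : t ^ (-(k : ℝ) / 2) = (√t)⁻¹ ^ k := by
    rw [Real.sqrt_eq_rpow, ← Real.rpow_neg ht.le, ← Real.rpow_natCast, ← Real.rpow_mul ht.le]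
    congr 1
    ring
  rw [exitDensityTerm, tsum_exitDensityInnerTerm γ ht, h, neg_pow, pow_succ, div_pow, mul_pow,
    mul_pow, mul_pow, inv_pow]
  ring

theorem summable_exitDensityTerm (δ γ : ℝ) {t : ℝ} (ht : 0 < t) (x : ℝ) :
    Summable fun k : ℕ => exitDensityTerm δ γ t x k :=
  ((summable_mul_pow (summable_abs_halfGammaSum_coeff _) _).mul_left _).congr
    fun k => (exitDensityTerm_eq δ γ ht x k).symm

/-- The probability that a Brownian motion with drift `γ` exceeds the level `δ x` before time `t`. -/
noncomputable def exitTail (δ γ t x : ℝ) : ℝ :=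
  gaussTail ((δ * x - γ * t) / √(2 * t))
    + Real.exp (2 * γ * (δ * x)) * gaussTail ((δ * x + γ * t) / √(2 * t))

theorem hasDerivAt_exitTail (δ γ : ℝ) {t : ℝ} (ht : 0 < t) (x : ℝ) :
    HasDerivAt (exitTail δ γ t) (-exitDensity δ γ t x) x := by
  have hs : √t ≠ 0 := (Real.sqrt_pos.2 ht).ne'
  have hr : √(2 : ℝ) ≠ 0 := (Real.sqrt_pos.2 two_pos).ne'
  have hr2 : √(2 : ℝ) ^ 2 = 2 := Real.sq_sqrt (by norm_num)
  have hs2 : √t ^ 2 = t := Real.sq_sqrt ht.le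
  have e1 : HasDerivAt (fun x : ℝ => (δ * x - γ * t) / √(2 * t)) (δ / √(2 * t)) x := by
    simpa using (((hasDerivAt_id x).const_mul δ).sub_const (γ * t)).div_const (√(2 * t))
  have e2 : HasDerivAt (fun x : ℝ => (δ * x + γ * t) / √(2 * t)) (δ / √(2 * t)) x := by
    simpa using (((hasDerivAt_id x).const_mul δ).add_const (γ * t)).div_const (√(2 * t))
  have e3 : HasDerivAt (fun x : ℝ => 2 * γ * (δ * x)) (2 * γ * δ) x := by
    simpa using ((hasDerivAt_id x).const_mul δ).const_mul (2 * γ)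
  refine (((hasDerivAt_gaussTail _).comp x e1).add
    (e3.exp.mul ((hasDerivAt_gaussTail _).comp x e2))).congr_deriv ?_
  have hdens : exitDensity δ γ t x = Real.exp (-γ ^ 2 / 2 * t + δ * γ * x) * (√2 * δ / √t) *
      ((√Real.pi)⁻¹ * Real.exp (-(√2 * δ * x / √t) ^ 2 / 4)
        - 2 * (γ * √(2 * t) / 2) * Real.exp (γ * √(2 * t) / 2 * (√2 * δ * x / √t)
          + (γ * √(2 * t) / 2) ^ 2) * gaussTail (√2 * δ * x / √t / 2 + γ * √(2 * t) / 2)) := by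
    rw [exitDensity, tsum_congr (exitDensityTerm_eq δ γ ht x), tsum_mul_left,
      tsum_halfGammaSum_coeff]
  have hv : √2 * δ * x / √t / 2 + γ * √(2 * t) / 2 = (δ * x + γ * t) / √(2 * t) := by
    rw [Real.sqrt_mul two_pos.le, eq_div_iff (by positivity)]
    field_simp
    rw [hr2, hs2]
    ring
  have hA : Real.exp (-γ ^ 2 / 2 * t + δ * γ * x) * Real.exp (-(√2 * δ * x / √t) ^ 2 / 4)
      = Real.exp (-((δ * x - γ * t) / √(2 * t)) ^ 2) := by
    rw [← Real.exp_add]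
    congr 1
    rw [div_pow, div_pow, Real.sq_sqrt ht.le, Real.sq_sqrt (by positivity), mul_pow, mul_pow, hr2]
    field_simp
    ring
  -- The exponential prefactor turns one Gaussian exponent into the other, so differentiating the
  -- two tails contributes the same Gaussian term twice.
  have hB : Real.exp (2 * γ * (δ * x)) * Real.exp (-((δ * x + γ * t) / √(2 * t)) ^ 2)
      = Real.exp (-((δ * x - γ * t) / √(2 * t)) ^ 2) := by
    rw [← Real.exp_add]
    congr 1
    rw [div_pow, div_pow, Real.sq_sqrt (by positivity)]
    field_simp
    ring
  have hC : Real.exp (-γ ^ 2 / 2 * t + δ * γ * x) *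
      Real.exp (γ * √(2 * t) / 2 * (√2 * δ * x / √t) + (γ * √(2 * t) / 2) ^ 2)
      = Real.exp (2 * γ * (δ * x)) := by
    rw [← Real.exp_add]
    congr 1
    rw [div_pow, mul_pow, Real.sq_sqrt (by positivity), Real.sqrt_mul two_pos.le]
    field_simp
    rw [hr2]
    ring
  have hD : √2 * δ / √t = 2 * (δ / √(2 * t)) := by
    rw [Real.sqrt_mul two_pos.le]
    field_simp
    rw [hr2, mul_comm]
  have hE : √(2 * t) * (√2 * δ / √t) = 2 * δ := by
    rw [Real.sqrt_mul two_pos.le]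
    field_simp
    rw [hr2, mul_comm]
  rw [hdens, hv]
  simp only [Function.comp]
  linear_combination (-((√Real.pi)⁻¹ * (δ / √(2 * t)))) * hB + (√Real.pi)⁻¹ * (√2 * δ / √t) * hA
    - γ * gaussTail ((δ * x + γ * t) / √(2 * t)) * (√(2 * t) * (√2 * δ / √t)) * hC
    - γ * gaussTail ((δ * x + γ * t) / √(2 * t)) * Real.exp (2 * γ * (δ * x)) * hE
    + (√Real.pi)⁻¹ * Real.exp (-((δ * x - γ * t) / √(2 * t)) ^ 2) * hD

/-! ### The reflection functional of a Gaussian variable -/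

theorem setIntegral_Ioi_gaussianPDFReal (μ : ℝ) {v : ℝ≥0} (hv : v ≠ 0) (c : ℝ) :
    ∫ z in Ioi c, gaussianPDFReal μ v z = gaussTail ((c - μ) / √(2 * v)) := by
  have hv0 : (0 : ℝ) < v := by exact_mod_cast pos_iff_ne_zero.2 hv
  have hS : 0 < √(2 * (v : ℝ)) := Real.sqrt_pos.2 (by positivity)
  have hshift : ∫ z in Ioi c, gaussianPDFReal μ v z
      = ∫ z in Ioi (c - μ), (√(2 * Real.pi * v))⁻¹ * Real.exp (-((√(2 * v))⁻¹ * z) ^ 2) := by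
    rw [← integral_indicator measurableSet_Ioi, ← integral_indicator measurableSet_Ioi,
      
      ← integral_sub_right_eq_self ((Ioi (c - μ)).indicator _) μ]
    refine integral_congr_ae (Filter.Eventually.of_forall fun z => ?_)
    simp only [indicator, mem_Ioi, sub_lt_sub_iff_right, gaussianPDFReal]
    split_ifs with h
    · rw [mul_pow, inv_pow, Real.sq_sqrt (by positivity), neg_div, inv_mul_eq_div (2 * (v : ℝ))]
    · rfl
  rw [hshift, integral_const_mul,
    integral_comp_mul_left_Ioi (fun s => Real.exp (-s ^ 2)) (c - μ) (inv_pos.2 hS), gaussTail,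
    inv_inv, smul_eq_mul, inv_mul_eq_div _ (c - μ), ← mul_assoc,
    show 2 * Real.pi * (v : ℝ) = Real.pi * (2 * v) by ring, Real.sqrt_mul Real.pi_pos.le]
  congr 1
  field_simp

/-- The function whose expectation at time `t` is the probability that a Brownian motion with drift
`γ` exceeds `y` before time `t`. -/
noncomputable def reflectionWeight (γ y x : ℝ) : ℝ :=
  (Ioi y).indicator (fun x => 1 + Real.exp (2 * γ * (y - x))) x

theorem measurable_reflectionWeight (γ y : ℝ) : Measurable (reflectionWeight γ y) :=
  Measurable.indicator (by fun_prop) measurableSet_Ioi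

theorem reflectionWeight_nonneg (γ y x : ℝ) : 0 ≤ reflectionWeight γ y x :=
  indicator_nonneg (fun _ _ => by positivity) _

theorem reflectionWeight_of_le {γ y x : ℝ} (h : x ≤ y) : reflectionWeight γ y x = 0 :=
  indicator_of_notMem (by simpa using h) _

theorem reflectionWeight_le (γ y x : ℝ) :
    reflectionWeight γ y x ≤ 1 + Real.exp (2 * γ * (y - x)) :=
  indicator_le_self' (fun _ _ => by positivity) _

theorem integrable_exp_drift (γ y a : ℝ) (v : ℝ≥0) :
    Integrable (fun z => 1 + Real.exp (2 * γ * (y - (a + z)))) (gaussianReal 0 v) := by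
  refine (integrable_const 1).add ?_
  refine ((integrable_exp_mul_gaussianReal (-(2 * γ))).const_mul
    (Real.exp (2 * γ * (y - a)))).congr (Filter.Eventually.of_forall fun z => ?_)
  simp only
  rw [← Real.exp_add]
  congr 1
  ring

theorem integrable_reflectionWeight (γ y a : ℝ) (v : ℝ≥0) :
    Integrable (fun z => reflectionWeight γ y (a + z)) (gaussianReal 0 v) := by
  refine (integrable_exp_drift γ y a v).mono'
    ((measurable_reflectionWeight γ y).comp (by fun_prop)).aestronglyMeasurable
    (Filter.Eventually.of_forall fun z => ?_)
  rw [Real.norm_of_nonneg (reflectionWeight_nonneg _ _ _)]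
  exact reflectionWeight_le _ _ _

/-- The summand `1` gives a Gaussian tail directly. Tilting by `exp (-2γz)` and completing the
square moves the mean from `0` to `-2γr`, which gives the second tail. -/
theorem integral_reflectionWeight (γ y x : ℝ) {r : ℝ≥0} (hr : r ≠ 0) :
    ∫ z, reflectionWeight γ y (x + γ * r + z) ∂gaussianReal 0 r = exitTail 1 γ r (y - x) := by
  have hr0 : (0 : ℝ) < r := by exact_mod_cast pos_iff_ne_zero.2 hr
  rw [integral_gaussianReal_eq_integral_smul hr]
  have h : ∀ z, gaussianPDFReal 0 r z • reflectionWeight γ y (x + γ * r + z)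
      = (Ioi (y - x - γ * r)).indicator (fun z => gaussianPDFReal 0 r z
        + Real.exp (2 * γ * (y - x)) * gaussianPDFReal (-(2 * γ * r)) r z) z := by
    intro z
    have hiff : y < x + γ * r + z ↔ y - x - γ * r < z := by constructor <;> intro h <;> linarith
    have hexp : Real.exp (-(z - 0) ^ 2 / (2 * r)) * Real.exp (2 * γ * (y - (x + γ * r + z)))
        = Real.exp (2 * γ * (y - x)) * Real.exp (-(z - -(2 * γ * r)) ^ 2 / (2 * r)) := by
      rw [← Real.exp_add, ← Real.exp_add]
      congr 1
      field_simp
      ring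
    simp only [reflectionWeight, indicator, mem_Ioi, hiff, gaussianPDFReal, smul_eq_mul]
    split_ifs
    · linear_combination (√(2 * Real.pi * r))⁻¹ * hexp
    · simp
  simp only [h]
  rw [integral_indicator measurableSet_Ioi, integral_add
    (integrable_gaussianPDFReal _ _).integrableOn
    ((integrable_gaussianPDFReal _ _).const_mul _).integrableOn, integral_const_mul,
    setIntegral_Ioi_gaussianPDFReal _ hr, setIntegral_Ioi_gaussianPDFReal _ hr, exitTail]
  congr 2
  · congr 1
    ring
  · simp
  · congr 1
    ring

theorem exitTail_eq_exitTail_one (δ γ t x : ℝ) : exitTail δ γ t x = exitTail 1 γ t (δ * x) := by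
  simp [exitTail]

/-- A path started at the level exceeds it with probability one; this value becomes the limit at the
first crossing and also the total mass of the density. -/
theorem exitTail_zero (δ γ t : ℝ) : exitTail δ γ t 0 = 1 := by
  have h := gaussTail_add_gaussTail_neg (γ * t / √(2 * t))
  simp only [exitTail, mul_zero, zero_sub, zero_add, Real.exp_zero, one_mul, neg_div]
  linarith

theorem continuousAt_exitTail_one (γ : ℝ) {p : ℝ × ℝ} (hp : 0 < p.1) :
    ContinuousAt (fun p : ℝ × ℝ => exitTail 1 γ p.1 p.2) p := by
  have hS : √(2 * p.1) ≠ 0 := (Real.sqrt_pos.2 (by positivity)).ne'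
  unfold exitTail
  refine ContinuousAt.add (continuous_gaussTail.continuousAt.comp (ContinuousAt.div ?_ ?_ hS))
    (ContinuousAt.mul ?_ (continuous_gaussTail.continuousAt.comp (ContinuousAt.div ?_ ?_ hS)))
  all_goals exact Continuous.continuousAt (by fun_prop)

/-- Uniform in `t`, hence a constant majorant at grid crossings, where the overshoot bound gives
`|b| ≤ 1`. -/
theorem abs_exitTail_one_le (γ t b : ℝ) : |exitTail 1 γ t b| ≤ 1 + Real.exp (2 * |γ| * |b|) := by
  have h1 := gaussTail_nonneg ((1 * b - γ * t) / √(2 * t))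
  have h2 := gaussTail_nonneg ((1 * b + γ * t) / √(2 * t))
  rw [exitTail, abs_of_nonneg (by positivity)]
  refine add_le_add (gaussTail_le_one _) ((mul_le_of_le_one_right (by positivity)
    (gaussTail_le_one _)).trans ?_)
  refine Real.exp_le_exp.2 ((le_abs_self _).trans_eq ?_)
  simp [abs_mul, mul_assoc]

/-! ### Path properties -/

/-- The exit time of the inverse Gaussian process is the maximum of the drifted path divided by
`δ`. -/
theorem inverseGaussianExitTime_eq {Ω : Type*} {B : ℝ≥0 → Ω → ℝ} {δ γ : ℝ} (hδ : 0 < δ) {t : ℝ≥0}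
    {ω : Ω} (hc : Continuous fun s => B s ω) (h0 : B 0 ω = 0) :
    ∃ s₀ ≤ t, (∀ s ≤ t, B s ω + γ * s ≤ B s₀ ω + γ * s₀) ∧
      inverseGaussianExitTime B δ γ t ω = ENNReal.ofReal ((B s₀ ω + γ * s₀) / δ) := by
  have hf : Continuous fun s : ℝ≥0 => B s ω + γ * s := by fun_prop
  obtain ⟨s₀, hs₀, hmax⟩ := (isCompact_Icc (a := (0 : ℝ≥0)) (b := t)).exists_isMaxOn
    ⟨0, by simp⟩ hf.continuousOn
  have hle : ∀ s ≤ t, B s ω + γ * s ≤ B s₀ ω + γ * s₀ := fun s hs => hmax ⟨zero_le, hs⟩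
  have hM : 0 ≤ B s₀ ω + γ * s₀ := by simpa [h0] using hle 0 zero_le
  refine ⟨s₀, hs₀.2, hle, le_antisymm ?_ ?_⟩
  · refine le_of_forall_gt fun w hw => ?_
    obtain ⟨v, hv1, hv2⟩ := ENNReal.lt_iff_exists_nnreal_btwn.1 hw
    refine lt_of_le_of_lt (sInf_le ⟨v, ⟨?_, ?_⟩, rfl⟩) hv2
    · exact_mod_cast lt_of_le_of_lt zero_le hv1
    · have hv : B s₀ ω + γ * s₀ < δ * v := by
        rw [ENNReal.ofReal_lt_iff_lt_toReal (by positivity) (by simp), ENNReal.coe_toReal,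
          div_lt_iff₀ hδ] at hv1
        linarith
      -- The strict inequality `G(v) > t` needs the path to stay below `δ v` slightly beyond `t`,
      -- not only up to `t`.
      have hev : ∀ᶠ s in nhds t, B s ω + γ * s < δ * v :=
        hf.continuousAt.eventually_lt continuousAt_const ((hle t le_rfl).trans_lt hv)
      obtain ⟨η, hη, hball⟩ := exists_Ico_subset_of_mem_nhds hev ⟨t + 1, by simp⟩
      refine lt_of_lt_of_le (ENNReal.coe_lt_coe.2 hη) (le_sInf ?_)
      rintro _ ⟨s, ⟨-, hs⟩, rfl⟩
      refine ENNReal.coe_le_coe.2 (not_lt.1 fun hlt => hs.not_gt ?_)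
      rcases le_total s t with h | h
      · exact (hle s h).trans_lt hv
      · exact hball ⟨h, hlt⟩
  · refine le_sInf ?_
    rintro _ ⟨w, ⟨-, hw⟩, rfl⟩
    rw [ENNReal.ofReal_le_iff_le_toReal (by simp), ENNReal.coe_toReal, div_le_iff₀ hδ]
    by_contra! hlt
    refine hw.not_ge (sInf_le_of_le ⟨s₀, ⟨pos_iff_ne_zero.2 ?_, ?_⟩, rfl⟩
      (ENNReal.coe_le_coe.2 hs₀.2))
    -- The infimum defining `G` runs over positive times; a maximiser at `0` would make the maximum
    -- `0`, which is not above `δ w`.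
    · rintro rfl
      rw [h0] at hlt
      have : 0 ≤ w * δ := by positivity
      simp at hlt
      linarith
    · linarith

/-- The points of the uniform grid with `n + 1` steps on `[0, t]`. -/
noncomputable def gridPoint (t : ℝ≥0) (n i : ℕ) : ℝ≥0 := t * (i / (n + 1))

theorem gridPoint_mono (t : ℝ≥0) (n : ℕ) : Monotone (gridPoint t n) := fun i j h => by
  unfold gridPoint
  gcongr

theorem gridPoint_lt_iff {t : ℝ≥0} (ht : 0 < t) {n i : ℕ} : gridPoint t n i < t ↔ i ≤ n := by
  have hn : (0 : ℝ≥0) < n + 1 := by positivity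
  rw [gridPoint, mul_lt_iff_lt_one_right ht, div_lt_one hn, ← Nat.lt_succ_iff]
  exact_mod_cast Iff.rfl

theorem exists_gridPoint_tendsto {t s : ℝ≥0} (ht : 0 < t) :
    ∃ k : ℕ → ℕ, Filter.Tendsto (fun n => gridPoint t n (k n)) Filter.atTop (nhds s) := by
  have ht' : (t : ℝ) ≠ 0 := by exact_mod_cast ht.ne'
  refine ⟨fun n => ⌈((s : ℝ) / t) * ((n + 1 : ℕ) : ℝ)⌉₊, NNReal.tendsto_coe.1 ?_⟩
  have h := ((tendsto_nat_ceil_mul_div_atTop (a := (s : ℝ) / t) (by positivity)).comp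
    ((tendsto_natCast_atTop_atTop (R := ℝ)).comp (Filter.tendsto_add_atTop_nat 1))).const_mul
    (t : ℝ)
  rw [mul_div_cancel₀ _ ht'] at h
  refine h.congr fun n => ?_
  simp [gridPoint]

/-- The path `f` exceeds `y` for the first time on the grid at the index `i`, and by at most `1`. -/
def IsFirstCrossing (f : ℝ≥0 → ℝ) (y : ℝ) (t : ℝ≥0) (n i : ℕ) : Prop :=
  (∀ j < i, f (gridPoint t n j) ≤ y) ∧ y < f (gridPoint t n i) ∧ f (gridPoint t n i) ≤ y + 1

theorem IsFirstCrossing.eq {f : ℝ≥0 → ℝ} {y : ℝ} {t : ℝ≥0} {n i j : ℕ}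
    (hi : IsFirstCrossing f y t n i) (hj : IsFirstCrossing f y t n j) : i = j := by
  rcases lt_trichotomy i j with h | h | h
  · exact absurd (hj.1 i h) (not_le.2 hi.2.1)
  · exact h
  · exact absurd (hi.1 j h) (not_le.2 hj.2.1)

/-- A continuous path that exceeds `y` before `t` has a first crossing time `τ < t`, and the first
crossings on the grids converge to it. -/
theorem exists_isFirstCrossing {f : ℝ≥0 → ℝ} (hf : Continuous f) {y : ℝ} (h0 : f 0 ≤ y) {t : ℝ≥0}
    (ht : 0 < t) (hex : ∃ s ≤ t, y < f s) :
    ∃ τ < t, f τ = y ∧ ∀ U ∈ nhds τ, ∀ᶠ n in Filter.atTop, ∃ i ≤ n,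
      IsFirstCrossing f y t n i ∧ gridPoint t n i ∈ U := by
  obtain ⟨s₁, hs₁, hys₁⟩ := hex
  set S : Set ℝ≥0 := {s | y < f s} with hS
  have hSo : IsOpen S := isOpen_lt continuous_const hf
  have hSne : S.Nonempty := ⟨s₁, hys₁⟩
  set τ := sInf S with hτ
  have hle : ∀ s ∈ S, τ ≤ s := fun s hs => csInf_le (OrderBot.bddBelow S) hs
  have hτS : τ ∉ S := by
    intro hmem
    have hpos : 0 < τ := pos_iff_ne_zero.2 fun h => by
      rw [h] at hmem
      exact absurd h0 (not_le.2 hmem)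
    obtain ⟨l, hl, hsub⟩ := exists_Ioc_subset_of_mem_nhds (hSo.mem_nhds hmem) ⟨0, hpos⟩
    obtain ⟨m, hm1, hm2⟩ := exists_between hl
    exact absurd (hle m (hsub ⟨hm1, hm2.le⟩)) (not_le.2 hm2)
  have hτy : f τ = y := by
    refine le_antisymm (not_lt.1 hτS) ?_
    have hcl : τ ∈ closure S := csInf_mem_closure hSne (OrderBot.bddBelow S)
    exact closure_minimal (fun s hs => (show y < f s from hs).le)
      (isClosed_le continuous_const hf) hcl
  have hlt : ∀ s ∈ S, τ < s := fun s hs =>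
    lt_of_le_of_ne (hle s hs) fun h => hτS (h ▸ hs)
  have hτt : τ < t := (hlt s₁ hys₁).trans_le hs₁
  refine ⟨τ, hτt, hτy, fun U hU => ?_⟩
  have hV : U ∩ {s | f s < y + 1} ∈ nhds τ :=
    Filter.inter_mem hU ((isOpen_lt hf continuous_const).mem_nhds (by simp [hτy]))
  obtain ⟨η, hη, hsub⟩ := exists_Ico_subset_of_mem_nhds hV ⟨t, hτt⟩
  -- Grid points close to `s₂` lie in `S` and below `min η t`, so the first grid point in `S` is
  -- caught between `τ` and `min η t`.
  obtain ⟨s₂, hs₂, hs₂η⟩ := exists_lt_of_csInf_lt hSne (show sInf S < min η t from lt_min hη hτt)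
  obtain ⟨k, hk⟩ := exists_gridPoint_tendsto (s := s₂) ht
  filter_upwards [hk.eventually (hSo.mem_nhds hs₂), hk.eventually (Iio_mem_nhds hs₂η)] with n hn1 hn2
  classical
  have hfind : ∃ i, gridPoint t n i ∈ S := ⟨k n, hn1⟩
  have hi := Nat.find_spec hfind
  have hik : gridPoint t n (Nat.find hfind) < min η t :=
    (gridPoint_mono t n (Nat.find_min' hfind hn1)).trans_lt hn2
  have hmem := hsub ⟨(hlt _ hi).le, hik.trans_le (min_le_left _ _)⟩
  exact ⟨Nat.find hfind, (gridPoint_lt_iff ht).1 (hik.trans_le (min_le_right _ _)),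
    ⟨fun j hj => not_lt.1 (Nat.find_min hfind hj), hi, hmem.2.le⟩, hmem.1⟩

/-! ### The maximum of a Brownian motion with drift -/

section Maximum

variable {Ω : Type*} [MeasurableSpace Ω] {P : Measure Ω} {B : ℝ≥0 → Ω → ℝ}

theorem integrable_reflectionWeight_brownian (hB : IsPreBrownianReal B P) (γ y : ℝ) (t : ℝ≥0) :
    Integrable (fun ω => reflectionWeight γ y (B t ω + γ * t)) P := by
  have h := integrable_reflectionWeight γ y (γ * t) t
  rw [← (hB.hasLaw_eval t).map_eq] at h
  refine (h.comp_aemeasurable (hB.aemeasurable t)).congr (Filter.Eventually.of_forall fun ω => ?_)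
  simp [add_comm]

theorem integral_reflectionWeight_brownian (hB : IsPreBrownianReal B P) (γ y : ℝ) {t : ℝ≥0}
    (ht : 0 < t) :
    ∫ ω, reflectionWeight γ y (B t ω + γ * t) ∂P = exitTail 1 γ t y := by
  have h := integral_reflectionWeight γ y 0 ht.ne'
  have hm : Measurable fun z => reflectionWeight γ y (0 + γ * t + z) :=
    (measurable_reflectionWeight γ y).comp (by fun_prop)
  rw [← (hB.hasLaw_eval t).map_eq,
    integral_map (hB.aemeasurable t) hm.aestronglyMeasurable, sub_zero] at h
  rw [← h]
  simp [add_comm]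

/-- The Markov property, applied to the reflection weight at a later time. -/
theorem integral_mul_reflectionWeight_brownian (hB : IsPreBrownianReal B P) (γ y : ℝ) {ι : Type*}
    [Countable ι] (τ : ι → ℝ≥0) (e : ι) (hτ : ∀ i, τ i ≤ τ e) {t : ℝ≥0} (ht : τ e < t)
    {Φ : (ι → ℝ) → ℝ} (hΦ : Measurable Φ) (hΦ1 : ∀ w, |Φ w| ≤ 1) :
    ∫ ω, Φ (fun i => B (τ i) ω) * reflectionWeight γ y (B t ω + γ * t) ∂P
      = ∫ ω, Φ (fun i => B (τ i) ω) *
          exitTail 1 γ ((t : ℝ) - τ e) (y - (B (τ e) ω + γ * τ e)) ∂P := by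
  have : IsProbabilityMeasure P := hB.isGaussianProcess.isProbabilityMeasure
  obtain ⟨r, rfl⟩ := exists_add_of_le ht.le
  have hr : r ≠ 0 := by rintro rfl; simp at ht
  set W : Ω → ι → ℝ := fun ω i => B (τ i) ω with hWdef
  set D : Ω → ℝ := fun ω => B (τ e + r) ω - B (τ e) ω with hDdef
  have hW : AEMeasurable W P := aemeasurable_pi_lambda _ fun i => hB.aemeasurable _
  have hD : HasLaw D (gaussianReal 0 r) P := (hB.shift (τ e)).hasLaw_eval r
  -- All sampled times precede `τ e`, so `W` is a function of the path up to `τ e`, which is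
  -- independent of the later increment `D`.
  have hind : IndepFun W D P := by
    have h1 : Measurable fun x : ℝ≥0 → ℝ => x r := by fun_prop
    have h2 : Measurable fun (p : Set.Iic (τ e) → ℝ) (i : ι) => p ⟨τ i, hτ i⟩ := by fun_prop
    exact ((hB.indepFun_shift (τ e)).comp h1 h2).symm
  have hmap := (indepFun_iff_map_prod_eq_prod_map_map hW hD.aemeasurable).1 hind
  rw [hD.map_eq] at hmap
  set g : (ι → ℝ) × ℝ → ℝ := fun p =>
    Φ p.1 * reflectionWeight γ y (p.1 e + γ * τ e + γ * r + p.2) with hgdef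
  have hg : Measurable g := (hΦ.comp measurable_fst).mul
    ((measurable_reflectionWeight γ y).comp (by fun_prop))
  have hgω : ∀ ω, Φ (W ω) * reflectionWeight γ y (B (τ e + r) ω + γ * (τ e + r : ℝ≥0))
      = g (W ω, D ω) := fun ω => by
    simp only [hgdef, hDdef, hWdef]
    congr 2
    push_cast
    ring
  have hWm : AEStronglyMeasurable (fun ω => Φ (W ω)) P :=
    (hΦ.comp_aemeasurable hW).aestronglyMeasurable
  have hint : Integrable g ((P.map W).prod (gaussianReal 0 r)) := by
    rw [← hmap, integrable_map_measure hg.aestronglyMeasurable (hW.prodMk hD.aemeasurable)]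
    refine ((integrable_reflectionWeight_brownian hB γ y (τ e + r)).bdd_mul (c := 1) hWm
      (Filter.Eventually.of_forall fun ω => hΦ1 _)).congr (Filter.Eventually.of_forall hgω)
  have hexit : Measurable fun w : ι → ℝ => Φ w * exitTail 1 γ r (y - (w e + γ * τ e)) := by
    have : Measurable fun b => exitTail 1 γ r b := by
      unfold exitTail
      exact ((continuous_gaussTail.comp (by fun_prop)).add
        ((Real.continuous_exp.comp (by fun_prop)).mul
          (continuous_gaussTail.comp (by fun_prop)))).measurable
    exact hΦ.mul (this.comp (by fun_prop))
  calc ∫ ω, Φ (W ω) * reflectionWeight γ y (B (τ e + r) ω + γ * (τ e + r : ℝ≥0)) ∂P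
      = ∫ p, g p ∂((P.map W).prod (gaussianReal 0 r)) := by
        rw [← hmap, integral_map (hW.prodMk hD.aemeasurable) hg.aestronglyMeasurable]
        exact integral_congr_ae (Filter.Eventually.of_forall hgω)
    _ = ∫ w, Φ w * exitTail 1 γ r (y - (w e + γ * τ e)) ∂(P.map W) := by
        rw [integral_prod _ hint]
        refine integral_congr_ae (Filter.Eventually.of_forall fun w => ?_)
        simp only [hgdef]
        rw [integral_const_mul, integral_reflectionWeight γ y (w e + γ * τ e) hr]
    _ = _ := by
        rw [integral_map hW hexit.aestronglyMeasurable]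
        simp [hWdef]

open Classical in
/-- The value of `g` at the index of the first crossing, `0` if there is none. -/
noncomputable def crossingValue (f : ℝ≥0 → ℝ) (y : ℝ) (t : ℝ≥0) (n : ℕ) (g : ℕ → ℝ) : ℝ :=
  ∑ i ∈ Finset.range (n + 1), if IsFirstCrossing f y t n i then g i else 0

theorem crossingValue_eq {f : ℝ≥0 → ℝ} {y : ℝ} {t : ℝ≥0} {n i : ℕ} (g : ℕ → ℝ) (hi : i ≤ n)
    (h : IsFirstCrossing f y t n i) : crossingValue f y t n g = g i := by
  classical
  rw [crossingValue, Finset.sum_eq_single i, if_pos h]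
  · exact fun j _ hj => if_neg fun h' => hj (h'.eq h)
  · exact fun hni => absurd (Finset.mem_range.2 (Nat.lt_succ_of_le hi)) hni

theorem crossingValue_eq_zero {f : ℝ≥0 → ℝ} {y : ℝ} {t : ℝ≥0} {n : ℕ} (g : ℕ → ℝ)
    (h : ∀ i ≤ n, ¬ IsFirstCrossing f y t n i) : crossingValue f y t n g = 0 := by
  classical
  exact Finset.sum_eq_zero fun i hi =>
    if_neg (h i (Nat.lt_succ_iff.1 (Finset.mem_range.1 hi)))

theorem abs_crossingValue_le {f : ℝ≥0 → ℝ} {y : ℝ} {t : ℝ≥0} {n : ℕ} {g : ℕ → ℝ} {K : ℝ}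
    (hK : 0 ≤ K) (h : ∀ i, IsFirstCrossing f y t n i → |g i| ≤ K) :
    |crossingValue f y t n g| ≤ K := by
  by_cases hex : ∃ i ≤ n, IsFirstCrossing f y t n i
  · obtain ⟨i, hi, hc⟩ := hex
    rw [crossingValue_eq g hi hc]
    exact h i hc
  · push Not at hex
    rwa [crossingValue_eq_zero g hex, abs_zero]

/-- The indicator of a first crossing as a function of the values of the undrifted path. -/
noncomputable def crossingIndicator (γ y : ℝ) (t : ℝ≥0) (n i : ℕ) : (Set.Iic i → ℝ) → ℝ :=
  Set.indicator ({w | ∀ j : Set.Iic i, j.1 < i → w j + γ * gridPoint t n j ≤ y} ∩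
    ({w | y < w ⟨i, Set.self_mem_Iic⟩ + γ * gridPoint t n i} ∩
      {w | w ⟨i, Set.self_mem_Iic⟩ + γ * gridPoint t n i ≤ y + 1})) 1

theorem measurable_crossingIndicator (γ y : ℝ) (t : ℝ≥0) (n i : ℕ) :
    Measurable (crossingIndicator γ y t n i) := by
  refine measurable_one.indicator (MeasurableSet.inter ?_ (MeasurableSet.inter ?_ ?_))
  · simp only [Set.ofPred_forall]
    exact MeasurableSet.iInter fun j => MeasurableSet.iInter fun _ =>
      measurableSet_le (by fun_prop) measurable_const
  · exact measurableSet_lt measurable_const (by fun_prop)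
  · exact measurableSet_le (by fun_prop) measurable_const

theorem abs_crossingIndicator_le (γ y : ℝ) (t : ℝ≥0) (n i : ℕ) (w : Set.Iic i → ℝ) :
    |crossingIndicator γ y t n i w| ≤ 1 := by
  unfold crossingIndicator indicator
  split_ifs <;> simp

open Classical in
theorem crossingIndicator_mul (γ y : ℝ) (t : ℝ≥0) (n i : ℕ) (b : ℝ≥0 → ℝ) (c : ℝ) :
    crossingIndicator γ y t n i (fun j => b (gridPoint t n j)) * c
      = if IsFirstCrossing (fun s => b s + γ * s) y t n i then c else 0 := by
  unfold crossingIndicator indicator IsFirstCrossing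
  by_cases h : (∀ j < i, b (gridPoint t n j) + γ * gridPoint t n j ≤ y) ∧
      y < b (gridPoint t n i) + γ * gridPoint t n i ∧
      b (gridPoint t n i) + γ * gridPoint t n i ≤ y + 1
  · rw [if_pos h, if_pos ⟨fun j hj => h.1 j hj, h.2⟩]
    simp
  · rw [if_neg h, if_neg fun h' => h ⟨fun j hj => h'.1 ⟨j, hj.le⟩ hj, h'.2⟩, zero_mul]

/-- Being the first crossing at index `i` depends only on the path up to that grid time, so the
Markov property applies to each `i` separately and the finitely many identities are added. -/
theorem integral_crossingValue (hB : IsPreBrownianReal B P) (γ y : ℝ) {t : ℝ≥0} (ht : 0 < t)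
    (n : ℕ) :
    AEStronglyMeasurable (fun ω => crossingValue (fun s => B s ω + γ * s) y t n
        fun _ => reflectionWeight γ y (B t ω + γ * t)) P ∧
    AEStronglyMeasurable (fun ω => crossingValue (fun s => B s ω + γ * s) y t n fun i =>
        exitTail 1 γ ((t : ℝ) - gridPoint t n i)
          (y - (B (gridPoint t n i) ω + γ * gridPoint t n i))) P ∧
    ∫ ω, crossingValue (fun s => B s ω + γ * s) y t n
        (fun _ => reflectionWeight γ y (B t ω + γ * t)) ∂P
      = ∫ ω, crossingValue (fun s => B s ω + γ * s) y t n (fun i =>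
        exitTail 1 γ ((t : ℝ) - gridPoint t n i)
          (y - (B (gridPoint t n i) ω + γ * gridPoint t n i))) ∂P := by
  classical
  have : IsProbabilityMeasure P := hB.isGaussianProcess.isProbabilityMeasure
  have hΦ : ∀ i, AEStronglyMeasurable
      (fun ω => crossingIndicator γ y t n i fun j => B (gridPoint t n j) ω) P := fun i =>
    ((measurable_crossingIndicator γ y t n i).comp_aemeasurable
      (aemeasurable_pi_lambda _ fun j => hB.aemeasurable _)).aestronglyMeasurable
  have h1 : ∀ i, Integrable (fun ω => if IsFirstCrossing (fun s => B s ω + γ * s) y t n i then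
      reflectionWeight γ y (B t ω + γ * t) else 0) P := fun i => by
    simp only [← crossingIndicator_mul γ y t n i (fun s => B s _)]
    exact (integrable_reflectionWeight_brownian hB γ y t).bdd_mul (c := 1) (hΦ i)
      (Filter.Eventually.of_forall fun ω => abs_crossingIndicator_le _ _ _ _ _ _)
  have h2 : ∀ i, Integrable (fun ω => if IsFirstCrossing (fun s => B s ω + γ * s) y t n i then
      exitTail 1 γ ((t : ℝ) - gridPoint t n i)
          (y - (B (gridPoint t n i) ω + γ * gridPoint t n i)) else 0) P := fun i => by
    refine Integrable.of_bound ?_ (1 + Real.exp (2 * |γ| * 1)) (Filter.Eventually.of_forall ?_)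
    · simp only [← crossingIndicator_mul γ y t n i (fun s => B s _)]
      have hcont : Continuous fun b => exitTail 1 γ ((t : ℝ) - gridPoint t n i) b := by
        unfold exitTail
        exact (continuous_gaussTail.comp (by fun_prop)).add
          ((Real.continuous_exp.comp (by fun_prop)).mul
            (continuous_gaussTail.comp (by fun_prop)))
      exact (hΦ i).mul (hcont.measurable.comp_aemeasurable
        (((hB.aemeasurable _).add_const _).const_sub _)).aestronglyMeasurable
    · intro ω
      split_ifs with h
      · refine (abs_exitTail_one_le _ _ _).trans ?_
        gcongr
        rw [abs_le]
        constructor <;> linarith [h.2.1, h.2.2]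
      · rw [norm_zero]; positivity
  refine ⟨?_, ?_, ?_⟩
  · exact (integrable_finsetSum _ fun i _ => h1 i).aestronglyMeasurable
  · exact (integrable_finsetSum _ fun i _ => h2 i).aestronglyMeasurable
  · unfold crossingValue
    rw [integral_finsetSum _ fun i _ => h1 i, integral_finsetSum _ fun i _ => h2 i]
    refine Finset.sum_congr rfl fun i hi => ?_
    have hlt : gridPoint t n i < t :=
      (gridPoint_lt_iff ht).2 (Nat.lt_succ_iff.1 (Finset.mem_range.1 hi))
    simp only [← crossingIndicator_mul γ y t n i (fun s => B s _)]
    exact integral_mul_reflectionWeight_brownian hB γ y (fun j : Set.Iic i => gridPoint t n j)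
      ⟨i, Set.self_mem_Iic⟩ (fun j => gridPoint_mono t n j.2) hlt (measurable_crossingIndicator γ y t n i)
      (abs_crossingIndicator_le γ y t n i)

/-- At the first crossing the path equals `y` and the remaining time is positive, so continuity of
the tail there forces the limit `exitTail 1 γ (t - τ) 0 = 1`. -/
theorem tendsto_crossingValue_exitTail {f : ℝ≥0 → ℝ} (hf : Continuous f) {y : ℝ} (h0 : f 0 ≤ y)
    {t : ℝ≥0} (ht : 0 < t) (hex : ∃ s ≤ t, y < f s) (γ : ℝ) :
    Filter.Tendsto (fun n => crossingValue f y t n fun i =>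
      exitTail 1 γ ((t : ℝ) - gridPoint t n i) (y - f (gridPoint t n i))) Filter.atTop (nhds 1) := by
  obtain ⟨τ, hτt, hτy, hτ⟩ := exists_isFirstCrossing hf h0 ht hex
  have hpos : (0 : ℝ) < (t : ℝ) - τ := sub_pos.2 (by exact_mod_cast hτt)
  have hc : ContinuousAt (fun s : ℝ≥0 => exitTail 1 γ ((t : ℝ) - s) (y - f s)) τ :=
    ContinuousAt.comp (f := fun s : ℝ≥0 => ((t : ℝ) - s, y - f s))
      (g := fun p : ℝ × ℝ => exitTail 1 γ p.1 p.2) (continuousAt_exitTail_one γ hpos)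
      (Continuous.continuousAt (by fun_prop))
  intro V hV
  have hU : (fun s : ℝ≥0 => exitTail 1 γ ((t : ℝ) - s) (y - f s)) ⁻¹' V ∈ nhds τ := by
    refine hc.preimage_mem_nhds ?_
    simpa only [hτy, sub_self, exitTail_zero] using hV
  rw [Filter.mem_map]
  filter_upwards [hτ _ hU] with n hn
  obtain ⟨i, hi, hcr, hmem⟩ := hn
  rw [mem_preimage, crossingValue_eq _ hi hcr]
  exact hmem

/-- The law of the maximum of a Brownian motion with drift. -/
theorem measureReal_exists_lt_brownian (hB : IsBrownianReal B P) (γ : ℝ) {y : ℝ} (hy : 0 ≤ y)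
    {t : ℝ≥0} (ht : 0 < t) :
    NullMeasurableSet {ω | ∃ s ≤ t, y < B s ω + γ * s} P ∧
      P.real {ω | ∃ s ≤ t, y < B s ω + γ * s} = exitTail 1 γ t y := by
  have hpre := hB.toIsPreBrownianReal
  have : IsProbabilityMeasure P := hpre.isGaussianProcess.isProbabilityMeasure
  set E : Set Ω := {ω | ∃ s ≤ t, y < B s ω + γ * s} with hE
  have hnot : ∀ ω ∉ E, ∀ n g, crossingValue (fun s => B s ω + γ * s) y t n g = 0 := by
    intro ω hω n g
    refine crossingValue_eq_zero g fun i hi hcr => hω ⟨gridPoint t n i, ?_, hcr.2.1⟩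
    exact ((gridPoint_lt_iff ht).2 hi).le
  have hY : ∀ᵐ ω ∂P, Filter.Tendsto (fun n => crossingValue (fun s => B s ω + γ * s) y t n fun i =>
      exitTail 1 γ ((t : ℝ) - gridPoint t n i)
        (y - (B (gridPoint t n i) ω + γ * gridPoint t n i))) Filter.atTop
      (nhds (E.indicator (fun _ => (1 : ℝ)) ω)) := by
    filter_upwards [hB.cont, hpre.eval_zero_ae_eq_zero] with ω hc h0
    by_cases hω : ω ∈ E
    · rw [indicator_of_mem hω]
      exact tendsto_crossingValue_exitTail (f := fun s => B s ω + γ * s) (by fun_prop)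
        (by simpa [h0] using hy) ht hω γ
    · rw [indicator_of_notMem hω]
      simp only [hnot ω hω]
      exact tendsto_const_nhds
  -- On `E` a grid crossing eventually exists, so the value is eventually the weight itself; off `E`
  -- the path ends at or below `y`, where the weight vanishes.
  have hZ : ∀ᵐ ω ∂P, Filter.Tendsto (fun n => crossingValue (fun s => B s ω + γ * s) y t n fun _ =>
      reflectionWeight γ y (B t ω + γ * t)) Filter.atTop
      (nhds (reflectionWeight γ y (B t ω + γ * t))) := by
    filter_upwards [hB.cont, hpre.eval_zero_ae_eq_zero] with ω hc h0
    by_cases hω : ω ∈ E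
    · obtain ⟨τ, -, -, hτ⟩ := exists_isFirstCrossing (f := fun s => B s ω + γ * s) (by fun_prop)
        (by simpa [h0] using hy) ht hω
      refine tendsto_const_nhds.congr' ?_
      filter_upwards [hτ _ Filter.univ_mem] with n hn
      obtain ⟨i, hi, hcr, -⟩ := hn
      rw [crossingValue_eq _ hi hcr]
    · have hle : B t ω + γ * t ≤ y := not_lt.1 fun h => hω ⟨t, le_rfl, h⟩
      simp only [hnot ω hω, reflectionWeight_of_le hle]
      exact tendsto_const_nhds
  have hmeas := fun n => integral_crossingValue hpre γ y ht n
  have limY := tendsto_integral_of_dominated_convergence (fun _ => 1 + Real.exp (2 * |γ| * 1))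
    (fun n => (hmeas n).2.1) (integrable_const _) (fun n => Filter.Eventually.of_forall fun ω => by
      refine abs_crossingValue_le (by positivity) fun i h => (abs_exitTail_one_le _ _ _).trans ?_
      gcongr
      rw [abs_le]
      constructor <;> linarith [h.2.1, h.2.2]) hY
  have limZ := tendsto_integral_of_dominated_convergence
    (fun ω => reflectionWeight γ y (B t ω + γ * t))
    (fun n => (hmeas n).1) (integrable_reflectionWeight_brownian hpre γ y t)
    (fun n => Filter.Eventually.of_forall fun ω =>
      abs_crossingValue_le (reflectionWeight_nonneg _ _ _) fun i _ =>
        (abs_of_nonneg (reflectionWeight_nonneg _ _ _)).le) hZ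
  simp only [(hmeas _).2.2] at limZ
  have hEm : NullMeasurableSet E P := by
    -- `E` is an uncountable union, so its null-measurability is read off from its indicator being
    -- an a.e. limit of measurable functions.
    have h : AEMeasurable (E.indicator fun _ => (1 : ℝ)) P :=
      aemeasurable_of_tendsto_metrizable_ae' (fun n => (hmeas n).2.1.aemeasurable) hY
    exact (aemeasurable_indicator_const_iff 1).1 h
  refine ⟨hEm, ?_⟩
  have h := tendsto_nhds_unique limY limZ
  rw [integral_reflectionWeight_brownian hpre γ y ht, integral_indicator₀ hEm] at h
  simpa using h

end Maximum

/-! ### The law of the exit time -/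

section ExitTime

variable {Ω : Type*} [MeasurableSpace Ω] {P : Measure Ω} {B : ℝ≥0 → Ω → ℝ}

theorem ae_inverseGaussianExitTime (hB : IsBrownianReal B P) {δ : ℝ} (hδ : 0 < δ) (γ : ℝ)
    (t : ℝ≥0) :
    ∀ᵐ ω ∂P, inverseGaussianExitTime B δ γ t ω ≠ ∞ ∧ ∀ x : ℝ, 0 ≤ x →
      (x < (inverseGaussianExitTime B δ γ t ω).toReal ↔ ∃ s ≤ t, δ * x < B s ω + γ * s) := by
  filter_upwards [hB.cont, hB.toIsPreBrownianReal.eval_zero_ae_eq_zero] with ω hc h0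
  obtain ⟨s₀, hs₀, hmax, hQ⟩ := inverseGaussianExitTime_eq (γ := γ) hδ (t := t) hc h0
  have hM : 0 ≤ B s₀ ω + γ * s₀ := by simpa [h0] using hmax 0 zero_le
  rw [hQ]
  refine ⟨ENNReal.ofReal_ne_top, fun x hx => ?_⟩
  rw [ENNReal.toReal_ofReal (by positivity), lt_div_iff₀ hδ, mul_comm]
  exact ⟨fun h => ⟨s₀, hs₀, h⟩, fun ⟨s, hs, h⟩ => h.trans_le (hmax s hs)⟩

theorem measure_lt_inverseGaussianExitTime (hB : IsBrownianReal B P) {δ : ℝ} (hδ : 0 < δ) (γ : ℝ)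
    {t : ℝ≥0} (ht : 0 < t) {x : ℝ} (hx : 0 ≤ x) :
    NullMeasurableSet {ω | x < (inverseGaussianExitTime B δ γ t ω).toReal} P ∧
      P.real {ω | x < (inverseGaussianExitTime B δ γ t ω).toReal} = exitTail δ γ t x := by
  obtain ⟨h1, h2⟩ := measureReal_exists_lt_brownian hB γ (mul_nonneg hδ.le hx) ht
  have hae : {ω | ∃ s ≤ t, δ * x < B s ω + γ * s} =ᵐ[P]
      {ω | x < (inverseGaussianExitTime B δ γ t ω).toReal} := by
    filter_upwards [ae_inverseGaussianExitTime hB hδ γ t] with ω hω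
    exact propext (hω.2 x hx).symm
  exact ⟨h1.congr hae, by rw [← measureReal_congr hae, h2, ← exitTail_eq_exitTail_one]⟩

theorem aemeasurable_inverseGaussianExitTime (hB : IsBrownianReal B P) {δ : ℝ} (hδ : 0 < δ)
    (γ : ℝ) {t : ℝ≥0} (ht : 0 < t) :
    AEMeasurable (fun ω => (inverseGaussianExitTime B δ γ t ω).toReal) P := by
  refine NullMeasurable.aemeasurable ?_
  have h : @Measurable (NullMeasurableSpace Ω P) ℝ _ _
      (fun ω => (inverseGaussianExitTime B δ γ t ω).toReal) := by
    refine measurable_of_Ioi fun x => ?_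
    rcases le_or_gt 0 x with hx | hx
    · exact (measure_lt_inverseGaussianExitTime hB hδ γ ht hx).1
    · convert MeasurableSet.univ
      exact eq_univ_of_forall fun ω => hx.trans_le ENNReal.toReal_nonneg
  exact fun s hs => h hs

/-- The sign is not visible in the series: it holds because the density is minus the derivative of a
tail probability, which is antitone. -/
theorem exitDensity_nonneg (hB : IsBrownianReal B P) {δ : ℝ} (hδ : 0 < δ) (γ : ℝ) {t : ℝ≥0}
    (ht : 0 < t) {x : ℝ} (hx : 0 < x) : 0 ≤ exitDensity δ γ t x := by
  have : IsProbabilityMeasure P := hB.toIsPreBrownianReal.isGaussianProcess.isProbabilityMeasure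
  have hanti : AntitoneOn (exitTail δ γ t) (Ici 0) := fun a ha b hb hab => by
    rw [← (measure_lt_inverseGaussianExitTime hB hδ γ ht ha).2,
      ← (measure_lt_inverseGaussianExitTime hB hδ γ ht hb).2]
    exact measureReal_mono fun ω (hω : b < _) => hab.trans_lt hω
  have h := hanti.derivWithin_nonpos (x := x)
  rw [derivWithin_of_mem_nhds (Ici_mem_nhds hx),
    (hasDerivAt_exitTail δ γ (NNReal.coe_pos.2 ht) x).deriv] at h
  linarith

theorem hasLaw_inverseGaussianExitTime (hB : IsBrownianReal B P) {δ : ℝ} (hδ : 0 < δ) (γ : ℝ)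
    {t : ℝ≥0} (ht : 0 < t) :
    HasLaw (fun ω => (inverseGaussianExitTime B δ γ t ω).toReal)
      ((volume.restrict (Ioi (0 : ℝ))).withDensity
        (fun x => ENNReal.ofReal (exitDensity δ γ t x))) P := by
  have : IsProbabilityMeasure P := hB.toIsPreBrownianReal.isGaussianProcess.isProbabilityMeasure
  have hQ := aemeasurable_inverseGaussianExitTime hB hδ γ ht
  refine ⟨hQ, ?_⟩
  set μ := P.map (fun ω => (inverseGaussianExitTime B δ γ t ω).toReal) with hμ
  set ν := (volume.restrict (Ioi (0 : ℝ))).withDensity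
    (fun x => ENNReal.ofReal (exitDensity δ γ t x)) with hν
  have : IsProbabilityMeasure μ := Measure.isProbabilityMeasure_map hQ
  have hμx : ∀ x, 0 ≤ x → μ.real (Ioi x) = exitTail δ γ t x := fun x hx => by
    rw [← (measure_lt_inverseGaussianExitTime hB hδ γ ht hx).2, hμ,
      map_measureReal_apply_of_aemeasurable hQ measurableSet_Ioi]
    rfl
  -- No Gaussian asymptotics are needed: the tail is that of the probability measure `μ`. The limit
  -- lets the density be integrated up to infinity.
  have hlim : Filter.Tendsto (exitTail δ γ t) Filter.atTop (nhds 0) := by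
    have h := (tendsto_cdf_atTop μ).const_sub 1
    rw [sub_self] at h
    refine h.congr' ?_
    filter_upwards [Filter.eventually_ge_atTop 0] with x hx
    rw [← hμx x hx, cdf_eq_real, ← compl_Iic, probReal_compl_eq_one_sub measurableSet_Iic]
  have hνx : ∀ x, 0 ≤ x → ν (Ioi x) = ENNReal.ofReal (exitTail δ γ t x) := fun x hx => by
    have hd : ∀ z ∈ Ici x, HasDerivAt (exitTail δ γ t) (-exitDensity δ γ t z) z := fun z _ =>
      hasDerivAt_exitTail δ γ (NNReal.coe_pos.2 ht) z
    have hnn : ∀ z ∈ Ioi x, 0 ≤ exitDensity δ γ t z := fun z hz =>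
      exitDensity_nonneg hB hδ γ ht (hx.trans_lt hz)
    have hnp : ∀ z ∈ Ioi x, -exitDensity δ γ t z ≤ 0 := fun z hz => neg_nonpos.2 (hnn z hz)
    have hint := (integrableOn_Ioi_deriv_of_nonpos' hd hnp hlim).neg
    have hval := integral_Ioi_of_hasDerivAt_of_nonpos' hd hnp hlim
    rw [integral_neg] at hval
    rw [hν, withDensity_apply _ measurableSet_Ioi, Measure.restrict_restrict measurableSet_Ioi,
      Ioi_inter_Ioi, max_eq_left hx, ← ofReal_integral_eq_lintegral_ofReal]
    · congr 1
      linarith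
    · exact hint.congr (Filter.Eventually.of_forall fun z => by simp)
    · exact (ae_restrict_iff' measurableSet_Ioi).2 (Filter.Eventually.of_forall hnn)
  have hν0 : ν (Iic 0) = 0 := by
    rw [hν, withDensity_apply _ measurableSet_Iic, Measure.restrict_restrict measurableSet_Iic,
      Iic_inter_Ioi, Ioc_self, Measure.restrict_empty, lintegral_zero_measure]
  have : IsProbabilityMeasure ν := ⟨by
    rw [← Iic_union_Ioi (a := (0 : ℝ)), measure_union (Iic_disjoint_Ioi le_rfl) measurableSet_Ioi,
      hν0, hνx 0 le_rfl, exitTail_zero]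
    simp⟩
  have hμ0 : μ (Iic 0) = 0 := by
    have h := hμx 0 le_rfl
    rw [exitTail_zero, ← compl_Iic, probReal_compl_eq_one_sub measurableSet_Iic] at h
    exact (measureReal_eq_zero_iff).1 (by linarith)
  refine Measure.ext_of_Iic μ ν fun a => ?_
  rcases le_or_gt 0 a with ha | ha
  · have h : μ (Ioi a) = ν (Ioi a) := by
      rw [hνx a ha, ← hμx a ha, ofReal_measureReal]
    rw [← compl_Ioi, prob_compl_eq_one_sub measurableSet_Ioi,
      prob_compl_eq_one_sub measurableSet_Ioi, h]
  · rw [measure_mono_null (Iic_subset_Iic.2 ha.le) hμ0, measure_mono_null (Iic_subset_Iic.2 ha.le) hν0]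

end ExitTime

theorem mainTheorem11 {Ω : Type*} [MeasurableSpace Ω] (P : Measure Ω)
    (B : ℝ≥0 → Ω → ℝ) (hB : IsBrownianReal B P)
    (δ γ : ℝ) (hδ : 0 < δ) (t : ℝ≥0) (ht : 0 < t) :
    (∀ x : ℝ, 0 < x →
      (∀ k : ℕ, Summable (fun m : ℕ => exitDensityInnerTerm γ t k m)) ∧
      Summable (fun k : ℕ => exitDensityTerm δ γ t x k) ∧
      0 ≤ exitDensity δ γ t x) ∧
    (∀ᵐ ω ∂P, inverseGaussianExitTime B δ γ t ω ≠ ∞) ∧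
    HasLaw (fun ω => (inverseGaussianExitTime B δ γ t ω).toReal)
      ((volume.restrict (Ioi (0 : ℝ))).withDensity
        (fun x => ENNReal.ofReal (exitDensity δ γ t x))) P := by
  have ht' : (0 : ℝ) < t := NNReal.coe_pos.2 ht
  exact ⟨fun x hx => ⟨summable_exitDensityInnerTerm γ ht', summable_exitDensityTerm δ γ ht' x,
    exitDensity_nonneg hB hδ γ ht hx⟩,
    (ae_inverseGaussianExitTime hB hδ γ t).mono fun _ h => h.1,
    hasLaw_inverseGaussianExitTime hB hδ γ ht⟩
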